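/- **Setting.** Let $\mathcal E$ be a finite-dimensional real inner product space with norm $\|\cdot\|$. Let $f:\mathcal E\to(-\infty,\infty]$ be convex and lower semicontinuous, with $\mathrm{dom}(f)=\{x: f(x)<\infty\}$ and $\mathrm{epi}(f)=\{(x,t)\in\mathcal E\times\mathbb R: f(x)\le t\}$. Let $S\subseteq\mathcal E$ be closed and convex, let $A$ be a linear map on $\mathcal E$, let $b$ be a vector, and let $\mathrm{Feas}=\{x\in S: Ax=b\}$. Let $\bar e\in\mathrm{int}(S\cap\mathrm{dom}(f))$ with $A\bar e=b$, let $\hat f\in\mathbb R$ with $\hat f>f(\bar e)$, and let $0<\epsilon<1$. Put $$\bar D=\mathrm{diam}\{x\in\mathrm{Feas}: f(x)\le f(\bar e)\},\qquad \hat r=\sup\{r\ge 0:\ \|x-\bar e\|\le r,\ Ax=b\ \Rightarrow\ x\in S,\ f(x)\le\hat f\},$$ and assume $\bar D<\infty$. If $\hat r=\infty$, read $\bar D/\hat r$ as $0$. No Lipschitz assumption is made on $f$. **Line search.** For $x\in\mathcal E$ and $t,\alpha\in\mathbb R$ let $x(\alpha)=\bar e+\alpha(x-\bar e)$ and $t(\alpha)=\hat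 f+\alpha(t-\hat f)$. Let $$\alpha(x,t)=\min\big\{\sup\{\alpha: x(\alpha)\in S\},\ \sup\{\alpha: f(x(\alpha))\le t(\alpha)\}\big\},\qquad \pi'(x,t)=\big(x(\alpha),t(\alpha)\big)\ \text{ at }\ \alpha=\alpha(x,t).$$ **Directions.** Let $N_C(p)$ denote the normal cone of $C$ at $p$, where $\mathcal E\times\mathbb R$ has the inner product $\langle x_1,x_2\rangle+t_1t_2$. Let $$G_1(x')=\Big\{\tfrac{-1}{\langle v,\bar e-x'\rangle}v:\ 0\ne v\in N_S(x')\Big\},\qquad G_2(x',t')=\Big\{\tfrac{-1}{\langle v,\bar e-x'\rangle+(\hat f-t')\delta}v:\ 0\ne(v,\delta)\in N_{\mathrm{epi}(f)}(x',t')\Big\}.$$ Define $G(x',t')$ as $G_1(x')$ if $x'\in\mathrm{bdy}(S)$ and $(x',t')\notin\mathrm{bdy}(\mathrm{epi}(f))$; as $G_2(x',t')$ if $x'\notin\mathrm{bdy}(S)$ and $(x',t')\in\mathrm{bdy}(\mathrm{epi}(f))$; and as the convex hull of $G_1(x')\cup G_2(x',t')$ if both boundary conditions hold. Let $P$ be the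 orthogonal projection of $\mathcal E$ onto $\ker A$. **Algorithm A.** Start with $(x_0,t_0)=(x_0',t_0')=(\bar e,f(\bar e))$. For $k=0,1,2,\dots$ choose any $g'\in G(x_k',t_k')$ and set $$\tilde x_{k+1}=x_k-\frac{\epsilon}{2\|P(g')\|^2}P(g')\quad(\tilde x_{k+1}=x_k\text{ if }P(g')=0),\qquad \alpha_{k+1}=\alpha(\tilde x_{k+1},t_k),\qquad (x_{k+1}',t_{k+1}')=\pi'(\tilde x_{k+1},t_k).$$ If $\alpha_{k+1}\ge 4/3$, let $(x_{k+1},t_{k+1})=(x_{k+1}',t_{k+1}')$; otherwise let $(x_{k+1},t_{k+1})=(\tilde x_{k+1},t_k)$. **Theorem.** Algorithm A can be run: there is an infinite sequence of iterates that it generates. The minimum $f^*$ of $f$ over $\mathrm{Feas}$ is attained and finite. For every sequence of iterates generated by Algorithm A, whatever the choices of $g'$, each $x_k'$ lies in $\mathrm{Feas}\cap\mathrm{dom}(f)$, and for every integer $\ell\ge 0$, $$\ell\ \ge\ 8\Big(\frac{\bar D}{\hat r}\Big)^2\Big(\frac1{\epsilon^2}+\frac1\epsilon\log_{4/3}\Big(1+\frac{\bar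 D}{\hat r}\Big)\Big)\quad\Longrightarrow\quad \min_{k\le\ell}\ \frac{f(x_k')-f^*}{\hat f-f^*}\ \le\ \epsilon .$$ -/

import Mathlib

open scoped InnerProductSpace ENNReal

noncomputable section

namespace SubgradA

/-- The data of the problem `min f(x)` subject to `x ∈ S`, `A x = b`, together with the inputs
`ebar` and `fhat` of the algorithm. The assumptions on these data are hypotheses of the theorem. -/
structure Data (E F : Type*) [NormedAddCommGroup E] [InnerProductSpace ℝ E]
    [AddCommGroup F] [Module ℝ F] where
  f : E → EReal
  S : Set E
  A : E →ₗ[ℝ] F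
  b : F
  ebar : E
  fhat : ℝ

/-- An iterate `(x_k, t_k)`, `(x'_k, t'_k)` of the algorithm; the primed pair is `(xp, tp)`. -/
structure State (E : Type*) where
  x : E
  t : ℝ
  xp : E
  tp : ℝ

variable {E F : Type*} [NormedAddCommGroup E] [InnerProductSpace ℝ E]
  [AddCommGroup F] [Module ℝ F]

/-- Effective domain of a function with values in `(-∞, ∞]`. -/
def dom (f : E → EReal) : Set E := {x | f x < ⊤}

/-- Epigraph. -/
def epi (f : E → EReal) : Set (E × ℝ) := {p | f p.1 ≤ (p.2 : EReal)}

/-- Normal cone of `C` at `x`. -/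
def normalCone (C : Set E) (x : E) : Set E := {v | ∀ y ∈ C, ⟪v, y - x⟫_ℝ ≤ 0}

/-- Normal cone of `C ⊆ E × ℝ` at `p`, for the inner product `⟪x₁, x₂⟫ + t₁ t₂` on pairs. -/
def normalConePair (C : Set (E × ℝ)) (p : E × ℝ) : Set (E × ℝ) :=
  {v | ∀ q ∈ C, ⟪v.1, q.1 - p.1⟫_ℝ + v.2 * (q.2 - p.2) ≤ 0}

namespace Data

variable (d : Data E F)

/-- The feasible set. -/
def Feas : Set E := {x | x ∈ d.S ∧ d.A x = d.b}

/-- The diameter of the sublevel set `{x ∈ Feas | f x ≤ f ebar}`. -/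
def Dbar : ℝ≥0∞ := Metric.ediam {x | x ∈ d.Feas ∧ d.f x ≤ d.f d.ebar}

/-- The supremum of the radii `r` of balls around `ebar` that, inside `{A x = b}`, are contained
in `S` and in the sublevel set of `f` at level `fhat`. -/
def rhat : ℝ≥0∞ :=
  sSup {r | ∃ ρ : ℝ, 0 ≤ ρ ∧ r = ENNReal.ofReal ρ ∧
    ∀ x, ‖x - d.ebar‖ ≤ ρ ∧ d.A x = d.b → x ∈ d.S ∧ d.f x ≤ (d.fhat : EReal)}

/-- The point `x(α)` of the ray. -/
def rayX (x : E) (α : ℝ) : E := d.ebar + α • (x - d.ebar)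

/-- The height `t(α)` of the ray. -/
def rayT (t α : ℝ) : ℝ := d.fhat + α * (t - d.fhat)

def alpha1 (x : E) : EReal := sSup ((fun α : ℝ => (α : EReal)) '' {α | d.rayX x α ∈ d.S})

def alpha2 (x : E) (t : ℝ) : EReal :=
  sSup ((fun α : ℝ => (α : EReal)) '' {α | d.f (d.rayX x α) ≤ (d.rayT t α : EReal)})

/-- The result of the line search. The minimum is positive and finite whenever `A x = b` and
`t < fhat`, under the assumptions of the theorem. -/
def alpha (x : E) (t : ℝ) : ℝ := (min (d.alpha1 x) (d.alpha2 x t)).toReal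

/-- The radial projection of `(x, t)` from `(ebar, fhat)`. -/
def radialProj (x : E) (t : ℝ) : E × ℝ :=
  (d.rayX x (d.alpha x t), d.rayT t (d.alpha x t))

def G1 (xp : E) : Set E :=
  {g | ∃ v ∈ normalCone d.S xp, v ≠ 0 ∧ g = (-1 / ⟪v, d.ebar - xp⟫_ℝ) • v}

def G2 (xp : E) (tp : ℝ) : Set E :=
  {g | ∃ v : E, ∃ δ : ℝ, (v, δ) ∈ normalConePair (epi d.f) (xp, tp) ∧ (v, δ) ≠ 0 ∧
    g = (-1 / (⟪v, d.ebar - xp⟫_ℝ + (d.fhat - tp) * δ)) • v}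

def bdy1 : Set (E × ℝ) := {p | p.1 ∈ frontier d.S}

def bdy2 : Set (E × ℝ) := frontier (epi d.f)

/-- The set from which the algorithm picks its direction (no choice is available outside
`bdy1 ∪ bdy2`). -/
def G (xp : E) (tp : ℝ) : Set E :=
  {g | ((xp, tp) ∈ d.bdy1 \ d.bdy2 ∧ g ∈ d.G1 xp) ∨
    ((xp, tp) ∈ d.bdy2 \ d.bdy1 ∧ g ∈ d.G2 xp tp) ∨
    ((xp, tp) ∈ d.bdy1 ∩ d.bdy2 ∧ g ∈ convexHull ℝ (d.G1 xp ∪ d.G2 xp tp))}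

/-- The initial iterate. -/
def init : State E where
  x := d.ebar
  t := (d.f d.ebar).toReal
  xp := d.ebar
  tp := (d.f d.ebar).toReal

variable [FiniteDimensional ℝ E]

/-- Orthogonal projection onto the kernel of `A`. -/
def P : E →L[ℝ] E := (LinearMap.ker d.A).starProjection

/-- The subgradient step along `g`, with no movement if `P g = 0`. -/
def xtilde (ε : ℝ) (s : State E) (g : E) : E := s.x - (ε / (2 * ‖d.P g‖ ^ 2)) • d.P g

/-- One iteration, for the chosen direction `g`. -/
def step (ε : ℝ) (s : State E) (g : E) : State E :=
  let z := d.xtilde ε s g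
  let p := d.radialProj z s.t
  if 4 / 3 ≤ d.alpha z s.t then ⟨p.1, p.2, p.1, p.2⟩ else ⟨z, s.t, p.1, p.2⟩

/-- `s` is a sequence of iterates that the algorithm can generate with accuracy parameter `ε`. -/
def IsRun (ε : ℝ) (s : ℕ → State E) : Prop :=
  s 0 = d.init ∧ ∀ k, ∃ g ∈ d.G (s k).xp (s k).tp, s (k + 1) = d.step ε (s k) g

end Data

end SubgradA

end

/-! Write `C` for the part of the epigraph of `f` above `S`. The line search is a search in `C`
along the ray from the interior point `(ebar, fhat)`, and every direction `g` is the first component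
of a functional supporting `C` at the primed point, scaled to take the value `1` there when
`(ebar, fhat)` is the origin. Let `u ≤ 1` be the depth of `t` below `fhat` relative to that of the
minimum, and let `w` be the point at height `t` of the segment from `(ebar, fhat)` to an optimal
point. Evaluating the functional at `w` gives `⟪P g, x - w⟫ ≥ 1 / α - u`, and evaluating it on the
feasible ball of radius `ρ` at height `fhat` gives `‖P g‖ ≤ 1 / ρ`. So as long as the primed point
is not `ε`-optimal, each step moves `x` towards `w`, which lies within `Dbar` of every starting
point of a phase between two rescalings.

A rescaling multiplies `u` by at least `4 / 3`, and initially `1 / u ≤ 1 + Dbar / ρ`, which bounds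
the number of rescalings. Since `α < 4 / 3`, the gap `1 / α - u` is at least `3 / 4 * ε` before
`ε`-optimality, and at least `3 / 16` if `u ≤ 9 / 16`. Hence a phase takes at most
`8 / ε * (Dbar / ρ) ^ 2` steps, except for the last few, with `u > 9 / 16`, which take at most
`2 / ε ^ 2 * (Dbar / ρ) ^ 2` each. A potential function adds up these costs.
-/

noncomputable section

namespace SubgradA

open AffineMap Filter Topology

section Ray

variable {V : Type*} [AddCommGroup V] [Module ℝ V] {C C' : Set V} {e z : V}

/-- The supremum of the parameters `α` at which the line through `e` (at `α = 0`) and `z` (at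
`α = 1`) meets `C`; the step length of a line search in `C`. -/
def raySup (C : Set V) (e z : V) : EReal :=
  sSup ((fun α : ℝ => (α : EReal)) '' {α | lineMap e z α ∈ C})

lemma lineMap_mem_of_lt_raySup (hC : Convex ℝ C) (he : e ∈ C) {α : ℝ} (hα : 0 ≤ α)
    (h : (α : EReal) < raySup C e z) : lineMap e z α ∈ C := by
  obtain ⟨_, ⟨β, hβ, rfl⟩, hlt⟩ := lt_sSup_iff.1 h
  have hαβ : α < β := EReal.coe_lt_coe_iff.1 hlt
  have hβ0 : 0 < β := hα.trans_lt hαβ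
  have hmem := hC.lineMap_mem he hβ ⟨div_nonneg hα hβ0.le, (div_le_one hβ0).2 hαβ.le⟩
  rwa [lineMap_lineMap_right, div_mul_cancel₀ _ hβ0.ne'] at hmem

lemma zero_le_raySup (he : e ∈ C) : 0 ≤ raySup C e z :=
  le_sSup ⟨0, by simpa using he, rfl⟩

lemma raySup_inter (hC : Convex ℝ C) (hC' : Convex ℝ C') (he : e ∈ C ∩ C') :
    raySup (C ∩ C') e z = min (raySup C e z) (raySup C' e z) := by
  refine le_antisymm (le_min (sSup_le_sSup ?_) (sSup_le_sSup ?_)) ?_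
  · exact Set.image_mono fun α hα => hα.1
  · exact Set.image_mono fun α hα => hα.2
  · refine EReal.ge_of_forall_gt_iff_ge.1 fun α hα => ?_
    rcases lt_or_ge α 0 with hα0 | hα0
    · exact (EReal.coe_nonpos.2 hα0.le).trans (zero_le_raySup he)
    · obtain ⟨h, h'⟩ := lt_min_iff.1 hα
      exact le_sSup ⟨α, ⟨lineMap_mem_of_lt_raySup hC he.1 hα0 h,
        lineMap_mem_of_lt_raySup hC' he.2 hα0 h'⟩, rfl⟩

variable [TopologicalSpace V] [IsTopologicalAddGroup V] [ContinuousSMul ℝ V]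

lemma exists_gt_lineMap_mem {α : ℝ} (h : lineMap e z α ∈ interior C) :
    ∃ β > α, lineMap e z β ∈ C :=
  (lineMap_continuous.continuousAt.eventually_mem (mem_interior_iff_mem_nhds.1 h)).exists_gt

lemma lt_raySup_of_lineMap_mem_interior {α : ℝ} (h : lineMap e z α ∈ interior C) :
    (α : EReal) < raySup C e z := by
  obtain ⟨β, hαβ, hβ⟩ := exists_gt_lineMap_mem h
  exact (EReal.coe_lt_coe_iff.2 hαβ).trans_le (le_sSup ⟨β, hβ, rfl⟩)

lemma raySup_pos (he : e ∈ interior C) : 0 < raySup C e z :=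
  lt_raySup_of_lineMap_mem_interior (by simpa using he)

lemma lineMap_toReal_raySup_mem_frontier (hC : Convex ℝ C) (he : e ∈ interior C)
    (htop : raySup C e z ≠ ⊤) : lineMap e z (raySup C e z).toReal ∈ frontier C := by
  have hpos : 0 < raySup C e z := raySup_pos he
  have hcoe : ((raySup C e z).toReal : EReal) = raySup C e z :=
    EReal.coe_toReal htop (ne_bot_of_gt hpos)
  have hα : 0 < (raySup C e z).toReal := EReal.toReal_pos hpos htop
  refine ⟨map_mem_closure lineMap_continuous (s := Set.Ico 0 (raySup C e z).toReal) ?_ ?_,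
    fun hinterior => (lt_raySup_of_lineMap_mem_interior hinterior).ne hcoe⟩
  · rw [closure_Ico hα.ne]
    exact ⟨hα.le, le_rfl⟩
  · intro β hβ
    exact lineMap_mem_of_lt_raySup hC (interior_subset he) hβ.1
      ((EReal.coe_lt_coe_iff.2 hβ.2).trans_eq hcoe)

end Ray

section Support

variable {V : Type*} [AddCommGroup V] [Module ℝ V] [TopologicalSpace V] {C C' : Set V}
  {e p y z : V} {φ : V →L[ℝ] ℝ}

/-- `φ` supports `C` at `p`, scaled so that `φ = 1` on the supporting hyperplane when `e` is taken
as the origin. For `e` interior to `C` this makes `φ` a subgradient of the gauge of `C - e`. -/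
structure IsNormalizedSupport (C : Set V) (e p : V) (φ : V →L[ℝ] ℝ) : Prop where
  apply_sub_le_one : ∀ q ∈ C, φ (q - e) ≤ 1
  apply_sub_eq_one : φ (p - e) = 1

lemma IsNormalizedSupport.mono (h : IsNormalizedSupport C e p φ) (hsub : C' ⊆ C) :
    IsNormalizedSupport C' e p φ :=
  ⟨fun q hq => h.apply_sub_le_one q (hsub hq), h.apply_sub_eq_one⟩

lemma IsNormalizedSupport.one_div_sub_le {α u : ℝ}
    (h : IsNormalizedSupport C e (lineMap e z α) φ) (hy : y ∈ C) (hu : 0 ≤ u) :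
    1 / α - u ≤ φ (z - lineMap e y u) := by
  have hz : φ (z - e) = 1 / α := by
    have := h.apply_sub_eq_one
    rw [← vsub_eq_sub, lineMap_vsub_left, map_smul, smul_eq_mul, vsub_eq_sub] at this
    exact eq_one_div_of_mul_eq_one_right this
  have hw : φ (lineMap e y u - e) ≤ u := by
    rw [← vsub_eq_sub, lineMap_vsub_left, map_smul, smul_eq_mul]
    exact mul_le_of_le_one_right hu (h.apply_sub_le_one y hy)
  rw [← sub_sub_sub_cancel_right z _ e, map_sub, hz]
  linarith

lemma convex_setOf_isNormalizedSupport (C : Set V) (e p : V) :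
    Convex ℝ {φ : V →L[ℝ] ℝ | IsNormalizedSupport C e p φ} := by
  intro φ hφ ψ hψ a b ha hb hab
  refine ⟨fun q hq => ?_, ?_⟩
  · calc a * φ (q - e) + b * ψ (q - e) ≤ a * 1 + b * 1 := by
          gcongr
          exacts [hφ.apply_sub_le_one q hq, hψ.apply_sub_le_one q hq]
      _ = 1 := by rw [mul_one, mul_one, hab]
  · change a * φ (p - e) + b * ψ (p - e) = 1
    rw [hφ.apply_sub_eq_one, hψ.apply_sub_eq_one, mul_one, mul_one, hab]

variable [IsTopologicalAddGroup V] [ContinuousSMul ℝ V]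

lemma apply_sub_neg_of_mem_interior (hφ : φ ≠ 0) (he : e ∈ interior C)
    (hle : ∀ q ∈ C, φ (q - p) ≤ 0) : φ (e - p) < 0 := by
  have hsub : φ '' interior C ⊆ Set.Iic (φ p) := by
    rintro _ ⟨q, hq, rfl⟩
    simpa using hle q (interior_subset hq)
  have hmem := interior_maximal hsub (φ.isOpenMap_of_ne_zero hφ _ isOpen_interior)
    (Set.mem_image_of_mem φ he)
  rw [interior_Iic] at hmem
  simpa using hmem

lemma isNormalizedSupport_smul (hφ : φ ≠ 0) (he : e ∈ interior C)
    (hle : ∀ q ∈ C, φ (q - p) ≤ 0) : IsNormalizedSupport C e p ((-1 / φ (e - p)) • φ) := by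
  have hneg : φ (e - p) < 0 := apply_sub_neg_of_mem_interior hφ he hle
  have hval (q : V) : ((-1 / φ (e - p)) • φ) (q - e) = 1 - φ (q - p) / φ (e - p) := by
    rw [← sub_sub_sub_cancel_right q e p, smul_apply, smul_eq_mul, map_sub φ (q - p), mul_sub,
      div_mul_cancel₀ _ hneg.ne]
    ring
  refine ⟨fun q hq => ?_, by rw [hval, sub_self, map_zero, zero_div, sub_zero]⟩
  rw [hval]
  exact sub_le_self _ (div_nonneg_of_nonpos (hle q hq) hneg.le)

end Support

section NormalCone

variable {E : Type*} [NormedAddCommGroup E] [InnerProductSpace ℝ E]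

/-- The functional on `E × ℝ` represented by `(v, δ)`, for the inner product
`⟪x₁, x₂⟫ + t₁ t₂` on pairs. -/
def pairing (v : E) (δ : ℝ) : E × ℝ →L[ℝ] ℝ :=
  (innerSL ℝ v).coprod (ContinuousLinearMap.toSpanSingleton ℝ δ)

@[simp] lemma pairing_apply (v : E) (δ : ℝ) (q : E × ℝ) :
    pairing v δ q = ⟪v, q.1⟫_ℝ + q.2 * δ := by
  simp [pairing]

lemma smul_pairing (a : ℝ) (v : E) (δ : ℝ) : a • pairing v δ = pairing (a • v) (a * δ) := by
  ext <;> simp [real_inner_smul_left]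

lemma pairing_add (v v' : E) (δ δ' : ℝ) :
    pairing (v + v') (δ + δ') = pairing v δ + pairing v' δ' := by
  ext <;> simp [inner_add_left]

lemma pairing_ne_zero {v : E} {δ : ℝ} (h : (v, δ) ≠ 0) : pairing v δ ≠ 0 := by
  contrapose! h
  have hv : pairing v δ (v, 0) = 0 := by rw [h, zero_apply]
  have hδ : pairing v δ (0, 1) = 0 := by rw [h, zero_apply]
  exact Prod.ext (by simpa using hv) (by simpa using hδ)

lemma exists_eq_pairing [CompleteSpace E] (φ : E × ℝ →L[ℝ] ℝ) : ∃ v δ, φ = pairing v δ := by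
  refine ⟨(InnerProductSpace.toDual ℝ E).symm (φ.comp (ContinuousLinearMap.inl ℝ E ℝ)),
    φ (0, 1), ?_⟩
  ext <;> simp

lemma mem_normalConePair_iff {C : Set (E × ℝ)} {p : E × ℝ} {v : E} {δ : ℝ} :
    (v, δ) ∈ normalConePair C p ↔ ∀ q ∈ C, pairing v δ (q - p) ≤ 0 := by
  simp only [normalConePair, Set.mem_ofPred_eq, pairing_apply, Prod.fst_sub, Prod.snd_sub,
    mul_comm δ]

lemma exists_isNormalizedSupport_pairing {C : Set (E × ℝ)} {e p : E × ℝ} {v : E} {δ : ℝ}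
    (he : e ∈ interior C) (hv : (v, δ) ∈ normalConePair C p) (hne : (v, δ) ≠ 0) :
    ∃ η, IsNormalizedSupport C e p
      (pairing ((-1 / (⟪v, e.1 - p.1⟫_ℝ + (e.2 - p.2) * δ)) • v) η) := by
  have h := isNormalizedSupport_smul (pairing_ne_zero hne) he (mem_normalConePair_iff.1 hv)
  rw [smul_pairing, pairing_apply, Prod.fst_sub, Prod.snd_sub] at h
  exact ⟨_, h⟩

lemma exists_mem_normalCone_ne_zero [CompleteSpace E] {C : Set E} (hC : Convex ℝ C)
    (hne : (interior C).Nonempty) {x : E} (hx : x ∉ interior C) : ∃ v ∈ normalCone C x, v ≠ 0 := by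
  obtain ⟨φ, hφ, hle⟩ := geometric_hahn_banach_of_nonempty_interior_point hC hx hne
  refine ⟨(InnerProductSpace.toDual ℝ E).symm φ, fun y hy => ?_, by simpa using hφ⟩
  rw [InnerProductSpace.toDual_symm_apply, map_sub]
  exact sub_nonpos.2 (hle y hy)

lemma exists_mem_normalConePair_ne_zero [CompleteSpace E] {C : Set (E × ℝ)} (hC : Convex ℝ C)
    (hne : (interior C).Nonempty) {p : E × ℝ} (hp : p ∉ interior C) :
    ∃ v δ, (v, δ) ∈ normalConePair C p ∧ (v, δ) ≠ 0 := by
  obtain ⟨φ, hφ, hle⟩ := geometric_hahn_banach_of_nonempty_interior_point hC hp hne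
  obtain ⟨v, δ, rfl⟩ := exists_eq_pairing φ
  refine ⟨v, δ, mem_normalConePair_iff.2 fun q hq => ?_, fun h0 => hφ ?_⟩
  · rw [map_sub]
    exact sub_nonpos.2 (hle q hq)
  · rw [Prod.mk_eq_zero] at h0
    ext <;> simp [h0.1, h0.2]

end NormalCone

section Epigraph

variable {E : Type*} {f : E → EReal}

lemma coe_toReal_of_mem_dom (hbot : ∀ x, f x ≠ ⊥) {x : E} (hx : x ∈ dom f) :
    ((f x).toReal : EReal) = f x :=
  EReal.coe_toReal (ne_of_lt hx) (hbot x)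

lemma isClosed_epi [TopologicalSpace E] (hf : LowerSemicontinuous f) : IsClosed (epi f) :=
  hf.isClosed_epigraph.preimage (f := fun p : E × ℝ => (p.1, (p.2 : EReal)))
    (continuous_fst.prodMk (continuous_coe_real_ereal.comp continuous_snd))

lemma convexOn_toReal [AddCommGroup E] [Module ℝ E] (hbot : ∀ x, f x ≠ ⊥)
    (hf : Convex ℝ (epi f)) : ConvexOn ℝ (dom f) fun x => (f x).toReal := by
  rw [convexOn_iff_convex_epigraph]
  convert hf using 1
  ext ⟨x, t⟩
  constructor
  · rintro ⟨hx, ht⟩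
    change f x ≤ t
    rw [← coe_toReal_of_mem_dom hbot hx]
    exact EReal.coe_le_coe_iff.2 ht
  · intro h
    have hx : x ∈ dom f := lt_of_le_of_lt h (EReal.coe_lt_top t)
    exact ⟨hx, EReal.coe_le_coe_iff.1 ((coe_toReal_of_mem_dom hbot hx).trans_le h)⟩

lemma mem_interior_epi [NormedAddCommGroup E] [NormedSpace ℝ E] [FiniteDimensional ℝ E]
    (hbot : ∀ x, f x ≠ ⊥) (hf : Convex ℝ (epi f)) {x : E} {t : ℝ}
    (hx : x ∈ interior (dom f)) (ht : f x < t) : (x, t) ∈ interior (epi f) := by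
  have hcont : ContinuousAt (fun p : E × ℝ => (f p.1).toReal) (x, t) :=
    ContinuousAt.comp (f := Prod.fst) (g := fun x => (f x).toReal)
      ((convexOn_toReal hbot hf).continuousOn_interior.continuousAt
        (isOpen_interior.mem_nhds hx)) continuousAt_fst
  have hlt : (f x).toReal < t := by
    rwa [← EReal.coe_lt_coe_iff, coe_toReal_of_mem_dom hbot (interior_subset hx)]
  rw [mem_interior_iff_mem_nhds]
  filter_upwards [hcont.eventually_lt continuousAt_snd hlt,
    continuousAt_fst.eventually_mem (mem_interior_iff_mem_nhds.1 hx)] with p hp hdom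
  change f p.1 ≤ p.2
  rw [← coe_toReal_of_mem_dom hbot hdom]
  exact EReal.coe_le_coe_iff.2 hp.le

end Epigraph

section SubgradientStep

variable {E : Type*} [NormedAddCommGroup E] [InnerProductSpace ℝ E] {x w p : E} {ε ρ γ : ℝ}

lemma norm_sub_smul_sq_add_le (hε : 0 < ε) (hρ : 0 ≤ ρ) (hγ : ε / 4 ≤ γ) (hp : ρ * ‖p‖ ≤ 1)
    (hin : γ ≤ ⟪p, x - w⟫_ℝ) :
    ‖x - (ε / (2 * ‖p‖ ^ 2)) • p - w‖ ^ 2 + ρ ^ 2 * (ε * γ - ε ^ 2 / 4) ≤ ‖x - w‖ ^ 2 := by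
  have hp0 : 0 < ‖p‖ := by
    rw [norm_pos_iff]
    rintro rfl
    rw [inner_zero_left] at hin
    linarith
  have hexpand : ‖x - (ε / (2 * ‖p‖ ^ 2)) • p - w‖ ^ 2 =
      ‖x - w‖ ^ 2 - (ε * ⟪p, x - w⟫_ℝ - ε ^ 2 / 4) / ‖p‖ ^ 2 := by
    rw [sub_right_comm, norm_sub_sq_real, inner_smul_right, norm_smul, Real.norm_eq_abs,
      mul_pow, sq_abs, real_inner_comm]
    field_simp
    ring
  have hgain : ρ ^ 2 * (ε * γ - ε ^ 2 / 4) ≤ (ε * ⟪p, x - w⟫_ℝ - ε ^ 2 / 4) / ‖p‖ ^ 2 := by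
    have hc : 0 ≤ ε * γ - ε ^ 2 / 4 := by nlinarith
    have hsq : (ρ * ‖p‖) ^ 2 ≤ 1 := pow_le_one₀ (by positivity) hp
    rw [le_div_iff₀ (by positivity)]
    calc ρ ^ 2 * (ε * γ - ε ^ 2 / 4) * ‖p‖ ^ 2 = (ρ * ‖p‖) ^ 2 * (ε * γ - ε ^ 2 / 4) := by ring
      _ ≤ ε * γ - ε ^ 2 / 4 := mul_le_of_le_one_left hc hsq
      _ ≤ ε * ⟪p, x - w⟫_ℝ - ε ^ 2 / 4 := by gcongr
  linarith

end SubgradientStep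

section Cost

variable {ε u γ L L' : ℝ}

/-- The number of steps, per unit of `(distance to the target / inner radius) ^ 2`, that may be
taken before the next rescaling by `4 / 3` when at most `L` rescalings remain. In terms of the
relative height `u` of `rescalesLeft`, the condition `L < 2` is `9 / 16 < u`. -/
def stepCost (ε L : ℝ) : ℝ := if L < 2 then 2 / ε ^ 2 else 8 / ε

/-- The number of steps, per unit of `(Dbar / inner radius) ^ 2`, that may be taken altogether when
at most `L` rescalings remain. Here `min (L + 1) 3` bounds the number of phases whose `stepCost`
is `2 / ε ^ 2`. -/
def totalCost (ε L : ℝ) : ℝ := 2 / ε ^ 2 * min (L + 1) 3 + 8 / ε * L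

lemma stepCost_nonneg (hε : 0 < ε) : 0 ≤ stepCost ε L := by
  unfold stepCost
  split_ifs <;> positivity

lemma stepCost_add_totalCost_le (hε : 0 < ε) (h : L' + 1 ≤ L) :
    stepCost ε L + totalCost ε L' ≤ totalCost ε L := by
  have hlin : 0 ≤ 8 / ε * (L - (L' + 1)) := mul_nonneg (by positivity) (sub_nonneg.2 h)
  unfold stepCost totalCost
  split_ifs with hL
  · have hconst : 0 ≤ 2 / ε ^ 2 * (L - (L' + 1)) := mul_nonneg (by positivity) (sub_nonneg.2 h)
    have : 0 < 8 / ε := by positivity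
    rw [min_eq_left (by linarith), min_eq_left (by linarith)]
    linarith
  · have : 2 / ε ^ 2 * min (L' + 1) 3 ≤ 2 / ε ^ 2 * min (L + 1) 3 := by
      gcongr
      linarith
    linarith

lemma stepCost_le_totalCost (hε : 0 < ε) (hL : 0 ≤ L) : stepCost ε L ≤ totalCost ε L := by
  unfold stepCost totalCost
  split_ifs with h
  · have : 0 ≤ 2 / ε ^ 2 * L := by positivity
    have : 0 ≤ 8 / ε * L := by positivity
    rw [min_eq_left (by linarith)]
    linarith
  · have : 0 ≤ 2 / ε ^ 2 * min (L + 1) 3 := by positivity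
    have : 0 ≤ 8 / ε * (L - 1) := mul_nonneg (by positivity) (by linarith)
    linarith

lemma totalCost_le (ε L : ℝ) : totalCost ε L ≤ 8 * (1 / ε ^ 2 + 1 / ε * L) := by
  calc totalCost ε L ≤ 2 / ε ^ 2 * 4 + 8 / ε * L := by
        unfold totalCost
        gcongr
        exact (min_le_right _ _).trans (by norm_num)
    _ = 8 * (1 / ε ^ 2 + 1 / ε * L) := by ring

lemma one_le_stepCost_mul (hε : 0 < ε) (hu : 0 < u) (hγε : 3 / 4 * ε ≤ γ) (hγu : 3 / 4 - u ≤ γ) :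
    1 ≤ stepCost ε (Real.logb (4 / 3) u⁻¹) * (ε * γ - ε ^ 2 / 4) := by
  unfold stepCost
  split_ifs with hL
  · calc (1 : ℝ) = 2 / ε ^ 2 * (ε * (3 / 4 * ε) - ε ^ 2 / 4) := by field_simp; norm_num
      _ ≤ 2 / ε ^ 2 * (ε * γ - ε ^ 2 / 4) := by gcongr
  · have hu' : u ≤ 9 / 16 := by
      rw [not_lt, Real.le_logb_iff_rpow_le (by norm_num) (inv_pos.2 hu),
        le_inv_comm₀ (by positivity) hu] at hL
      norm_num at hL
      exact hL
    calc (1 : ℝ) ≤ 8 * (γ - ε / 4) := by linarith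
      _ = 8 / ε * (ε * γ - ε ^ 2 / 4) := by field_simp

/-- The iteration bound of the theorem, as a function of the ratio `q` of `Dbar` to `rhat`. -/
def iterationBound (ε q : ℝ) : ℝ :=
  8 * q ^ 2 * (1 / ε ^ 2 + 1 / ε * Real.logb (4 / 3) (1 + q))

lemma continuousAt_iterationBound (ε : ℝ) {q : ℝ} (hq : 0 ≤ q) :
    ContinuousAt (iterationBound ε) q := by
  have hlog : ContinuousAt (fun q : ℝ => Real.logb (4 / 3) (1 + q)) q :=
    ContinuousAt.logb (by fun_prop) (by positivity)
  unfold iterationBound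
  fun_prop

end Cost

namespace Data

variable {E F : Type*} [NormedAddCommGroup E] [InnerProductSpace ℝ E]
  [AddCommGroup F] [Module ℝ F] {d : Data E F} {ε ρ m fstar t tp : ℝ} {x y xp g : E} {s : State E}

section Definitions

variable (d : Data E F)

/-- The assumptions of the theorem on the data, apart from boundedness of the sublevel set. -/
structure IsConvexProgram : Prop where
  ne_bot : ∀ x, d.f x ≠ ⊥
  lowerSemicontinuous : LowerSemicontinuous d.f
  convex_epi : Convex ℝ (epi d.f)
  isClosed_S : IsClosed d.S
  convex_S : Convex ℝ d.S
  ebar_mem_interior : d.ebar ∈ interior (d.S ∩ dom d.f)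
  map_ebar : d.A d.ebar = d.b
  f_ebar_lt : d.f d.ebar < d.fhat

/-- The part of the epigraph of `f` above `S`. The line search is a search in this one set: `alpha1`
and `alpha2` belong to the two sets whose intersection it is. -/
def epiOn : Set (E × ℝ) := Prod.fst ⁻¹' d.S ∩ epi d.f

/-- The point from which the radial projection projects. -/
def center : E × ℝ := (d.ebar, d.fhat)

/-- The sublevel set whose diameter is `Dbar`. -/
def initSublevel : Set E := {x | x ∈ d.Feas ∧ d.f x ≤ d.f d.ebar}

/-- What every iterate satisfies: `t` is a height above some feasible value and at most the initial
one, and the primed point is a boundary point on the ray from the center through the unprimed one,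
with parameter less than `4 / 3`. -/
structure Invariant (s : State E) : Prop where
  map_x : d.A s.x = d.b
  exists_le_t : ∃ x ∈ d.Feas, d.f x ≤ s.t
  t_le : s.t ≤ d.init.t
  mem_frontier : (s.xp, s.tp) ∈ frontier d.epiOn
  exists_lineMap : ∃ α : ℝ, 0 < α ∧ α < 4 / 3 ∧ (s.xp, s.tp) = lineMap d.center (s.x, s.t) α

/-- `fstar` is the minimum of `f` over the feasible set, attained at `y`. -/
structure IsMinimizer (y : E) (fstar : ℝ) : Prop where
  mem_Feas : y ∈ d.Feas
  f_eq : d.f y = fstar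
  mem_lowerBounds : (fstar : EReal) ∈ lowerBounds (d.f '' d.Feas)

/-- One of the radii whose supremum is `rhat`. -/
structure IsInnerRadius (ρ : ℝ) : Prop where
  nonneg : 0 ≤ ρ
  mem_epiOn : ∀ x, ‖x - d.ebar‖ ≤ ρ → d.A x = d.b → (x, d.fhat) ∈ d.epiOn

/-- The depth of the height `t` below `fhat`, relative to that of the optimal value `fstar`. -/
def relHeight (fstar t : ℝ) : ℝ := (d.fhat - t) / (d.fhat - fstar)

/-- The point over which the segment from the center to the optimal point `(y, fstar)` has
height `t`; the subgradient steps taken at height `t` approach it. -/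
def target (y : E) (fstar t : ℝ) : E := d.rayX y (d.relHeight fstar t)

/-- An upper bound for the number of rescalings still possible at height `t`: each multiplies the
relative height by at least `4 / 3`, and it never exceeds `1`. -/
def rescalesLeft (fstar t : ℝ) : ℝ := Real.logb (4 / 3) (d.relHeight fstar t)⁻¹

/-- The potential of the convergence proof: it charges the current distance to the target for the
steps before the next rescaling, and the diameter `Dbar` for those after it. -/
def potential (y : E) (fstar ε : ℝ) (s : State E) : ℝ :=
  stepCost ε (d.rescalesLeft fstar s.t) * ‖s.x - d.target y fstar s.t‖ ^ 2 +
    d.Dbar.toReal ^ 2 *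
      (totalCost ε (d.rescalesLeft fstar s.t) - stepCost ε (d.rescalesLeft fstar s.t))

lemma lineMap_center (x : E) (t α : ℝ) :
    lineMap d.center (x, t) α = (d.rayX x α, d.rayT t α) := by
  ext <;> simp [lineMap_apply, center, rayX, rayT, add_comm]

lemma radialProj_eq (x : E) (t : ℝ) :
    d.radialProj x t = lineMap d.center (x, t) (d.alpha x t) :=
  (d.lineMap_center x t _).symm

lemma map_P [FiniteDimensional ℝ E] (g : E) : d.A (d.P g) = 0 :=
  LinearMap.mem_ker.1 ((LinearMap.ker d.A).starProjection_apply_mem g)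

lemma map_xtilde [FiniteDimensional ℝ E] (hs : d.A s.x = d.b) (ε : ℝ) (g : E) :
    d.A (d.xtilde ε s g) = d.b := by
  rw [xtilde, map_sub, map_smul, map_P, smul_zero, sub_zero, hs]

lemma step_of_le [FiniteDimensional ℝ E] (h : 4 / 3 ≤ d.alpha (d.xtilde ε s g) s.t) :
    d.step ε s g =
      ⟨(d.radialProj (d.xtilde ε s g) s.t).1, (d.radialProj (d.xtilde ε s g) s.t).2,
        (d.radialProj (d.xtilde ε s g) s.t).1, (d.radialProj (d.xtilde ε s g) s.t).2⟩ :=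
  if_pos h

lemma step_of_lt [FiniteDimensional ℝ E] (h : d.alpha (d.xtilde ε s g) s.t < 4 / 3) :
    d.step ε s g =
      ⟨d.xtilde ε s g, s.t,
        (d.radialProj (d.xtilde ε s g) s.t).1, (d.radialProj (d.xtilde ε s g) s.t).2⟩ :=
  if_neg h.not_ge

end Definitions

lemma map_lineMap_center (he : d.A d.ebar = d.b) (hx : d.A x = d.b) (t α : ℝ) :
    d.A (lineMap d.center (x, t) α).1 = d.b := by
  simp [lineMap_center, rayX, he, hx]

lemma le_of_mem_epiOn {p : E × ℝ} (hm : (m : EReal) ∈ lowerBounds (d.f '' d.Feas))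
    (hp : p ∈ d.epiOn) (hA : d.A p.1 = d.b) : m ≤ p.2 :=
  EReal.coe_le_coe_iff.1 ((hm ⟨p.1, ⟨hp.1, hA⟩, rfl⟩).trans hp.2)

lemma relHeight_rayT (fstar t α : ℝ) :
    d.relHeight fstar (d.rayT t α) = α * d.relHeight fstar t := by
  simp only [relHeight, rayT]
  ring

lemma Invariant.fstar_le_t (hs : d.Invariant s) (hy : d.IsMinimizer y fstar) : fstar ≤ s.t := by
  obtain ⟨x, hx, hle⟩ := hs.exists_le_t
  exact EReal.coe_le_coe_iff.1 ((hy.mem_lowerBounds ⟨x, hx, rfl⟩).trans hle)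

lemma inner_P_eq [FiniteDimensional ℝ E] {w : E} (hw : d.A w = 0) (g : E) :
    ⟪d.P g, w⟫_ℝ = ⟪g, w⟫_ℝ := by
  rw [P, Submodule.inner_starProjection_left_eq_right,
    Submodule.starProjection_eq_self_iff.2 (LinearMap.mem_ker.2 hw)]

lemma norm_sub_le_Dbar (hD : d.Dbar ≠ ⊤) {z : E} (hx : x ∈ d.initSublevel)
    (hz : z ∈ d.initSublevel) : ‖x - z‖ ≤ d.Dbar.toReal := by
  rw [← dist_eq_norm, dist_edist]
  exact ENNReal.toReal_mono hD (Metric.edist_le_ediam_of_mem hx hz)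

namespace IsConvexProgram

section Geometry

lemma ebar_mem_dom (h : d.IsConvexProgram) : d.ebar ∈ dom d.f :=
  (interior_subset h.ebar_mem_interior).2

lemma ebar_mem_Feas (h : d.IsConvexProgram) : d.ebar ∈ d.Feas :=
  ⟨(interior_subset h.ebar_mem_interior).1, h.map_ebar⟩

lemma coe_init_t (h : d.IsConvexProgram) : (d.init.t : EReal) = d.f d.ebar :=
  coe_toReal_of_mem_dom h.ne_bot h.ebar_mem_dom

lemma init_t_lt (h : d.IsConvexProgram) : d.init.t < d.fhat :=
  EReal.coe_lt_coe_iff.1 (h.coe_init_t.trans_lt h.f_ebar_lt)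

lemma ebar_mem_interior_S (h : d.IsConvexProgram) : d.ebar ∈ interior d.S :=
  interior_mono Set.inter_subset_left h.ebar_mem_interior

lemma convex_preimage_fst_S (h : d.IsConvexProgram) :
    Convex ℝ (Prod.fst ⁻¹' d.S : Set (E × ℝ)) :=
  h.convex_S.linear_preimage (LinearMap.fst ℝ E ℝ)

lemma convex_epiOn (h : d.IsConvexProgram) : Convex ℝ d.epiOn :=
  h.convex_preimage_fst_S.inter h.convex_epi

lemma isClosed_epiOn (h : d.IsConvexProgram) : IsClosed d.epiOn :=
  (h.isClosed_S.preimage continuous_fst).inter (isClosed_epi h.lowerSemicontinuous)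

lemma mem_initSublevel_iff (h : d.IsConvexProgram) :
    x ∈ d.initSublevel ↔ (x, d.init.t) ∈ d.epiOn ∧ d.A x = d.b := by
  change (x ∈ d.S ∧ d.A x = d.b) ∧ d.f x ≤ d.f d.ebar ↔
    (x ∈ d.S ∧ d.f x ≤ (d.init.t : EReal)) ∧ d.A x = d.b
  rw [h.coe_init_t, and_right_comm]

lemma init_mem_epiOn (h : d.IsConvexProgram) : (d.ebar, d.init.t) ∈ d.epiOn :=
  ⟨h.ebar_mem_Feas.1, h.coe_init_t.ge⟩

lemma init_mem_frontier (h : d.IsConvexProgram) : (d.ebar, d.init.t) ∈ frontier d.epiOn := by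
  refine ⟨subset_closure h.init_mem_epiOn, fun hinterior => ?_⟩
  obtain ⟨β, hβ, hmem⟩ := exists_gt_lineMap_mem (e := d.center) (z := (d.ebar, d.init.t)) (α := 1)
    (by rwa [lineMap_apply_one])
  rw [lineMap_center, rayX, sub_self, smul_zero, add_zero] at hmem
  have hle : d.init.t ≤ d.rayT d.init.t β :=
    EReal.coe_le_coe_iff.1 (h.coe_init_t.trans_le hmem.2)
  rw [rayT] at hle
  nlinarith [h.init_t_lt]

lemma center_mem_interior_preimage_fst_S (h : d.IsConvexProgram) :
    d.center ∈ interior (Prod.fst ⁻¹' d.S) := by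
  rw [← isOpenMap_fst.preimage_interior_eq_interior_preimage continuous_fst]
  exact h.ebar_mem_interior_S

variable [FiniteDimensional ℝ E]

lemma center_mem_interior_epi (h : d.IsConvexProgram) : d.center ∈ interior (epi d.f) :=
  mem_interior_epi h.ne_bot h.convex_epi
    (interior_mono Set.inter_subset_right h.ebar_mem_interior) h.f_ebar_lt

lemma center_mem_interior (h : d.IsConvexProgram) : d.center ∈ interior d.epiOn := by
  rw [epiOn, interior_inter]
  exact ⟨h.center_mem_interior_preimage_fst_S, h.center_mem_interior_epi⟩

end Geometry

section LineSearch

variable [FiniteDimensional ℝ E]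

lemma alpha_eq (h : d.IsConvexProgram) (x : E) (t : ℝ) :
    d.alpha x t = (raySup d.epiOn d.center (x, t)).toReal := by
  rw [epiOn, raySup_inter h.convex_preimage_fst_S h.convex_epi
    (interior_subset h.center_mem_interior)]
  simp only [raySup, lineMap_center]
  rfl

lemma raySup_epiOn_ne_top (h : d.IsConvexProgram)
    (hm : (m : EReal) ∈ lowerBounds (d.f '' d.Feas)) (hx : d.A x = d.b) (ht : t < d.fhat) :
    raySup d.epiOn d.center (x, t) ≠ ⊤ := by
  intro htop
  obtain ⟨n, hn⟩ := exists_lt_nsmul (sub_pos.2 ht) (d.fhat - m)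
  have hmem : lineMap d.center (x, t) (n : ℝ) ∈ d.epiOn :=
    lineMap_mem_of_lt_raySup h.convex_epiOn (interior_subset h.center_mem_interior) n.cast_nonneg
      (htop ▸ EReal.coe_lt_top _)
  have hle := le_of_mem_epiOn hm hmem (map_lineMap_center h.map_ebar hx t n)
  rw [lineMap_center, rayT] at hle
  rw [nsmul_eq_mul] at hn
  linarith

lemma alpha_pos (h : d.IsConvexProgram) (hm : (m : EReal) ∈ lowerBounds (d.f '' d.Feas))
    (hx : d.A x = d.b) (ht : t < d.fhat) : 0 < d.alpha x t := by
  rw [h.alpha_eq]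
  exact EReal.toReal_pos (raySup_pos h.center_mem_interior) (h.raySup_epiOn_ne_top hm hx ht)

lemma radialProj_mem_frontier (h : d.IsConvexProgram)
    (hm : (m : EReal) ∈ lowerBounds (d.f '' d.Feas)) (hx : d.A x = d.b) (ht : t < d.fhat) :
    d.radialProj x t ∈ frontier d.epiOn := by
  rw [radialProj_eq, h.alpha_eq]
  exact lineMap_toReal_raySup_mem_frontier h.convex_epiOn h.center_mem_interior
    (h.raySup_epiOn_ne_top hm hx ht)

end LineSearch

section Directions

lemma G1_nonempty [FiniteDimensional ℝ E] (h : d.IsConvexProgram) (hb : (xp, tp) ∈ d.bdy1) :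
    (d.G1 xp).Nonempty := by
  obtain ⟨v, hv, hv0⟩ := exists_mem_normalCone_ne_zero h.convex_S ⟨_, h.ebar_mem_interior_S⟩ hb.2
  exact ⟨_, v, hv, hv0, rfl⟩

lemma exists_isNormalizedSupport_of_mem_G1 (h : d.IsConvexProgram) (hg : g ∈ d.G1 xp) :
    ∃ η, IsNormalizedSupport d.epiOn d.center (xp, tp) (pairing g η) := by
  obtain ⟨v, hv, hv0, rfl⟩ := hg
  have hpair : (v, (0 : ℝ)) ∈ normalConePair (Prod.fst ⁻¹' d.S) (xp, tp) := fun q hq => by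
    simpa using hv q.1 hq
  obtain ⟨η, hη⟩ := exists_isNormalizedSupport_pairing h.center_mem_interior_preimage_fst_S hpair
    (by simpa using hv0)
  rw [mul_zero, add_zero] at hη
  exact ⟨η, hη.mono Set.inter_subset_left⟩

variable [FiniteDimensional ℝ E]

lemma G2_nonempty (h : d.IsConvexProgram) (hb : (xp, tp) ∈ d.bdy2) : (d.G2 xp tp).Nonempty := by
  obtain ⟨v, δ, hv, hv0⟩ :=
    exists_mem_normalConePair_ne_zero h.convex_epi ⟨_, h.center_mem_interior_epi⟩ hb.2
  exact ⟨_, v, δ, hv, hv0, rfl⟩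

lemma G_nonempty (h : d.IsConvexProgram) (hb : (xp, tp) ∈ frontier d.epiOn) :
    (d.G xp tp).Nonempty := by
  have hor : (xp, tp) ∈ d.bdy1 ∨ (xp, tp) ∈ d.bdy2 := by
    refine (frontier_inter_subset _ _ hb).imp (fun hS => ?_) And.right
    rw [← isOpenMap_fst.preimage_frontier_eq_frontier_preimage continuous_fst] at hS
    exact hS.1
  by_cases hb1 : (xp, tp) ∈ d.bdy1
  · obtain ⟨g, hg⟩ := h.G1_nonempty hb1
    by_cases hb2 : (xp, tp) ∈ d.bdy2
    · exact ⟨g, Or.inr (Or.inr ⟨⟨hb1, hb2⟩, subset_convexHull ℝ _ (Or.inl hg)⟩)⟩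
    · exact ⟨g, Or.inl ⟨⟨hb1, hb2⟩, hg⟩⟩
  · have hb2 := hor.resolve_left hb1
    obtain ⟨g, hg⟩ := h.G2_nonempty hb2
    exact ⟨g, Or.inr (Or.inl ⟨⟨hb2, hb1⟩, hg⟩)⟩

lemma exists_isNormalizedSupport_of_mem_G2 (h : d.IsConvexProgram) (hg : g ∈ d.G2 xp tp) :
    ∃ η, IsNormalizedSupport d.epiOn d.center (xp, tp) (pairing g η) := by
  obtain ⟨v, δ, hv, hv0, rfl⟩ := hg
  obtain ⟨η, hη⟩ := exists_isNormalizedSupport_pairing h.center_mem_interior_epi hv hv0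
  exact ⟨η, hη.mono Set.inter_subset_right⟩

lemma exists_isNormalizedSupport (h : d.IsConvexProgram) (hg : g ∈ d.G xp tp) :
    ∃ η, IsNormalizedSupport d.epiOn d.center (xp, tp) (pairing g η) := by
  rcases hg with ⟨-, hg⟩ | ⟨-, hg⟩ | ⟨-, hg⟩
  · exact h.exists_isNormalizedSupport_of_mem_G1 hg
  · exact h.exists_isNormalizedSupport_of_mem_G2 hg
  · refine convexHull_min (t := {g | ∃ η, IsNormalizedSupport d.epiOn d.center (xp, tp)
      (pairing g η)}) (Set.union_subset (fun g hg => h.exists_isNormalizedSupport_of_mem_G1 hg)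
      fun g hg => h.exists_isNormalizedSupport_of_mem_G2 hg) ?_ hg
    rintro g₁ ⟨η₁, h₁⟩ g₂ ⟨η₂, h₂⟩ a b ha hb hab
    have hcomb := convex_setOf_isNormalizedSupport _ _ _ h₁ h₂ ha hb hab
    rw [smul_pairing, smul_pairing, ← pairing_add] at hcomb
    exact ⟨_, hcomb⟩

end Directions

section Runs

lemma invariant_init (h : d.IsConvexProgram) : d.Invariant d.init where
  map_x := h.map_ebar
  exists_le_t := ⟨d.ebar, h.ebar_mem_Feas, h.coe_init_t.ge⟩
  t_le := le_rfl
  mem_frontier := h.init_mem_frontier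
  exists_lineMap := ⟨1, one_pos, by norm_num, (lineMap_apply_one _ _).symm⟩

lemma xp_mem_Feas_inter_dom (h : d.IsConvexProgram) (hs : d.Invariant s) :
    s.xp ∈ d.Feas ∩ dom d.f := by
  have hmem := h.isClosed_epiOn.frontier_subset hs.mem_frontier
  obtain ⟨α, -, -, hα⟩ := hs.exists_lineMap
  have hA := map_lineMap_center h.map_ebar hs.map_x s.t α
  rw [← hα] at hA
  exact ⟨⟨hmem.1, hA⟩, lt_of_le_of_lt hmem.2 (EReal.coe_lt_top _)⟩

variable [FiniteDimensional ℝ E]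

lemma invariant_step (h : d.IsConvexProgram) (hm : (m : EReal) ∈ lowerBounds (d.f '' d.Feas))
    (hs : d.Invariant s) (ε : ℝ) (g : E) : d.Invariant (d.step ε s g) := by
  have hx : d.A (d.xtilde ε s g) = d.b := d.map_xtilde hs.map_x ε g
  have ht : s.t < d.fhat := hs.t_le.trans_lt h.init_t_lt
  have hfr := h.radialProj_mem_frontier hm hx ht
  rcases lt_or_ge (d.alpha (d.xtilde ε s g) s.t) (4 / 3) with hα | hα
  · rw [step_of_lt d hα]
    exact ⟨hx, hs.exists_le_t, hs.t_le, hfr, _, h.alpha_pos hm hx ht, hα, d.radialProj_eq _ _⟩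
  · rw [step_of_le d hα]
    have hmem := h.isClosed_epiOn.frontier_subset hfr
    have hA : d.A (d.radialProj (d.xtilde ε s g) s.t).1 = d.b := by
      rw [radialProj_eq]
      exact map_lineMap_center h.map_ebar hx _ _
    refine ⟨hA, ⟨_, ⟨hmem.1, hA⟩, hmem.2⟩, le_trans ?_ hs.t_le, hfr,
      1, one_pos, by norm_num, (lineMap_apply_one _ _).symm⟩
    change d.fhat + d.alpha (d.xtilde ε s g) s.t * (s.t - d.fhat) ≤ s.t
    nlinarith

lemma invariant_of_isRun (h : d.IsConvexProgram) (hm : (m : EReal) ∈ lowerBounds (d.f '' d.Feas))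
    {s : ℕ → State E} (hs : d.IsRun ε s) (k : ℕ) : d.Invariant (s k) := by
  induction k with
  | zero => exact hs.1 ▸ h.invariant_init
  | succ k ih =>
    obtain ⟨g, -, hg⟩ := hs.2 k
    exact hg ▸ h.invariant_step hm ih ε g

lemma exists_isRun (h : d.IsConvexProgram) (hm : (m : EReal) ∈ lowerBounds (d.f '' d.Feas))
    (ε : ℝ) : ∃ s, d.IsRun ε s := by
  choose! g hg using fun s (hs : d.Invariant s) => h.G_nonempty hs.mem_frontier
  let run (k : ℕ) : State E := (fun s => d.step ε s (g s))^[k] d.init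
  have hsucc (k : ℕ) : run (k + 1) = d.step ε (run k) (g (run k)) :=
    Function.iterate_succ_apply' _ _ _
  have hrun (k : ℕ) : d.Invariant (run k) := by
    induction k with
    | zero => exact h.invariant_init
    | succ k ih => exact hsucc k ▸ h.invariant_step hm ih ε _
  exact ⟨run, rfl, fun k => ⟨g (run k), hg _ (hrun k), hsucc k⟩⟩

end Runs

section Minimizer

lemma isClosed_initSublevel [FiniteDimensional ℝ E] (h : d.IsConvexProgram) :
    IsClosed d.initSublevel := by
  have haff : {x | d.A x = d.b} = (fun x => x - d.ebar) ⁻¹' (LinearMap.ker d.A : Set E) := by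
    ext x
    simp [h.map_ebar, sub_eq_zero]
  have hclosed : IsClosed {x | d.A x = d.b} := by
    rw [haff]
    exact (Submodule.closed_of_finiteDimensional _).preimage (by fun_prop)
  exact (h.isClosed_S.inter hclosed).inter (h.lowerSemicontinuous.isClosed_preimage _)

lemma exists_isMinimizer [FiniteDimensional ℝ E] (h : d.IsConvexProgram) (hD : d.Dbar ≠ ⊤) :
    ∃ y fstar, d.IsMinimizer y fstar := by
  have hcomp : IsCompact d.initSublevel :=
    Metric.isCompact_of_isClosed_isBounded h.isClosed_initSublevel
      (Metric.isBounded_iff_ediam_ne_top.2 hD)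
  have hne : d.initSublevel.Nonempty := ⟨d.ebar, h.ebar_mem_Feas, le_rfl⟩
  obtain ⟨y, hy, hmin⟩ := LowerSemicontinuousOn.exists_isMinOn
    hne hcomp (h.lowerSemicontinuous.lowerSemicontinuousOn _)
  have hcoe : ((d.f y).toReal : EReal) = d.f y :=
    coe_toReal_of_mem_dom h.ne_bot (hy.2.trans_lt h.ebar_mem_dom)
  refine ⟨y, (d.f y).toReal, hy.1, hcoe.symm, ?_⟩
  rintro _ ⟨x, hx, rfl⟩
  rw [hcoe]
  rcases le_total (d.f x) (d.f d.ebar) with hle | hle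
  · exact hmin ⟨hx, hle⟩
  · exact hy.2.trans hle

lemma fstar_le_init_t (h : d.IsConvexProgram) (hy : d.IsMinimizer y fstar) :
    fstar ≤ d.init.t :=
  le_of_mem_epiOn hy.mem_lowerBounds h.init_mem_epiOn h.map_ebar

lemma fstar_lt_fhat (h : d.IsConvexProgram) (hy : d.IsMinimizer y fstar) : fstar < d.fhat :=
  (h.fstar_le_init_t hy).trans_lt h.init_t_lt

lemma minimizer_mem_initSublevel (h : d.IsConvexProgram) (hy : d.IsMinimizer y fstar) :
    y ∈ d.initSublevel :=
  ⟨hy.mem_Feas, hy.f_eq.trans_le (hy.mem_lowerBounds ⟨d.ebar, h.ebar_mem_Feas, rfl⟩)⟩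

lemma relHeight_pos (h : d.IsConvexProgram) (hy : d.IsMinimizer y fstar) (ht : t ≤ d.init.t) :
    0 < d.relHeight fstar t :=
  div_pos (sub_pos.2 (ht.trans_lt h.init_t_lt)) (sub_pos.2 (h.fstar_lt_fhat hy))

lemma relHeight_le_one (h : d.IsConvexProgram) (hy : d.IsMinimizer y fstar) (ht : fstar ≤ t) :
    d.relHeight fstar t ≤ 1 :=
  (div_le_one (sub_pos.2 (h.fstar_lt_fhat hy))).2 (by gcongr)

lemma rescalesLeft_nonneg (h : d.IsConvexProgram) (hy : d.IsMinimizer y fstar) (hft : fstar ≤ t)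
    (ht : t ≤ d.init.t) : 0 ≤ d.rescalesLeft fstar t :=
  Real.logb_nonneg (by norm_num)
    ((one_le_inv₀ (h.relHeight_pos hy ht)).2 (h.relHeight_le_one hy hft))

lemma rescalesLeft_rayT_add_one_le (h : d.IsConvexProgram) (hy : d.IsMinimizer y fstar)
    (ht : t ≤ d.init.t) {α : ℝ} (hα : 4 / 3 ≤ α) :
    d.rescalesLeft fstar (d.rayT t α) + 1 ≤ d.rescalesLeft fstar t := by
  have hu := h.relHeight_pos hy ht
  have hα' : Real.logb (4 / 3) (4 / 3) ≤ Real.logb (4 / 3) α :=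
    Real.logb_le_logb_of_le (by norm_num) (by norm_num) hα
  rw [Real.logb_self_eq_one (by norm_num)] at hα'
  rw [rescalesLeft, rescalesLeft, relHeight_rayT, Real.logb_inv, Real.logb_inv,
    Real.logb_mul (by linarith) hu.ne']
  linarith

lemma lineMap_relHeight (h : d.IsConvexProgram) (hy : d.IsMinimizer y fstar) (t : ℝ) :
    lineMap d.center (y, fstar) (d.relHeight fstar t) = (d.target y fstar t, t) := by
  have hne : d.fhat - fstar ≠ 0 := (sub_pos.2 (h.fstar_lt_fhat hy)).ne'
  rw [lineMap_center, target, Prod.mk.injEq, rayT, relHeight]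
  refine ⟨rfl, ?_⟩
  field_simp
  ring

lemma target_mem_initSublevel (h : d.IsConvexProgram) (hy : d.IsMinimizer y fstar)
    (hft : fstar ≤ t) (ht : t ≤ d.init.t) : d.target y fstar t ∈ d.initSublevel := by
  have hmem := h.convex_epiOn.lineMap_mem h.init_mem_epiOn
    (h.mem_initSublevel_iff.1 (h.minimizer_mem_initSublevel hy)).1
    ⟨(h.relHeight_pos hy ht).le, h.relHeight_le_one hy hft⟩
  rw [h.mem_initSublevel_iff]
  refine ⟨?_, ?_⟩
  · convert hmem using 1
    ext <;> simp [lineMap_apply, target, rayX, add_comm]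
  · simp [target, rayX, h.map_ebar, hy.mem_Feas.2]

end Minimizer

section Separation

variable [FiniteDimensional ℝ E]

lemma one_div_sub_relHeight_le (h : d.IsConvexProgram) (hy : d.IsMinimizer y fstar)
    (hx : d.A x = d.b) (ht : t ≤ d.init.t) {α : ℝ}
    (hp : (xp, tp) = lineMap d.center (x, t) α) (hg : g ∈ d.G xp tp) :
    1 / α - d.relHeight fstar t ≤ ⟪d.P g, x - d.target y fstar t⟫_ℝ := by
  obtain ⟨η, hη⟩ := h.exists_isNormalizedSupport hg
  have hker : d.A (x - d.target y fstar t) = 0 := by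
    simp [target, rayX, hx, h.map_ebar, hy.mem_Feas.2]
  have hle := (hp ▸ hη).one_div_sub_le (y := (y, fstar)) ⟨hy.mem_Feas.1, hy.f_eq.le⟩
    (h.relHeight_pos hy ht).le
  rw [h.lineMap_relHeight hy, pairing_apply, Prod.snd_sub, sub_self, zero_mul, add_zero] at hle
  rwa [inner_P_eq hker]

lemma mul_norm_P_le (h : d.IsConvexProgram) (hρ : d.IsInnerRadius ρ) (hg : g ∈ d.G xp tp) :
    ρ * ‖d.P g‖ ≤ 1 := by
  rcases eq_or_ne (d.P g) 0 with h0 | h0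
  · simp [h0]
  have hn : 0 < ‖d.P g‖ := norm_pos_iff.2 h0
  obtain ⟨η, hη⟩ := h.exists_isNormalizedSupport hg
  have hmem : (d.ebar + (ρ / ‖d.P g‖) • d.P g, d.fhat) ∈ d.epiOn := by
    refine hρ.mem_epiOn _ ?_ (by simp [h.map_ebar, map_P])
    rw [add_sub_cancel_left, norm_smul, Real.norm_of_nonneg (div_nonneg hρ.nonneg hn.le),
      div_mul_cancel₀ _ hn.ne']
  have hle := hη.apply_sub_le_one _ hmem
  rw [center, Prod.mk_sub_mk, add_sub_cancel_left, sub_self, pairing_apply, zero_mul, add_zero,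
    real_inner_smul_right, ← inner_P_eq (d.map_P g), real_inner_self_eq_norm_sq] at hle
  calc ρ * ‖d.P g‖ = ρ / ‖d.P g‖ * ‖d.P g‖ ^ 2 := by field_simp
    _ ≤ 1 := hle

lemma inv_relHeight_init_le (h : d.IsConvexProgram) (hD : d.Dbar ≠ ⊤)
    (hy : d.IsMinimizer y fstar) (hρ : d.IsInnerRadius ρ) (hρ0 : 0 < ρ) :
    (d.relHeight fstar d.init.t)⁻¹ ≤ 1 + d.Dbar.toReal / ρ := by
  have hu := h.relHeight_pos hy le_rfl
  obtain ⟨g, hg⟩ := h.G_nonempty h.init_mem_frontier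
  have hgap := h.one_div_sub_relHeight_le hy h.map_ebar le_rfl (lineMap_apply_one _ _).symm hg
  have hdist := norm_sub_le_Dbar hD ⟨h.ebar_mem_Feas, le_rfl⟩ (h.minimizer_mem_initSublevel hy)
  have hP : ‖d.P g‖ ≤ 1 / ρ := by
    rw [le_div_iff₀' hρ0]
    exact h.mul_norm_P_le hρ hg
  have hinner : ⟪d.P g, d.ebar - d.target y fstar d.init.t⟫_ℝ ≤
      d.relHeight fstar d.init.t * (d.Dbar.toReal / ρ) := by
    calc ⟪d.P g, d.ebar - d.target y fstar d.init.t⟫_ℝ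
        = d.relHeight fstar d.init.t * ⟪d.P g, d.ebar - y⟫_ℝ := by
          rw [target, rayX, sub_add_cancel_left, ← smul_neg, neg_sub, real_inner_smul_right]
      _ ≤ d.relHeight fstar d.init.t * (1 / ρ * d.Dbar.toReal) := by
          gcongr
          exact (real_inner_le_norm _ _).trans (by gcongr)
      _ = d.relHeight fstar d.init.t * (d.Dbar.toReal / ρ) := by ring
  rw [inv_le_iff_one_le_mul₀' hu]
  linarith

lemma exists_gap (h : d.IsConvexProgram) (hy : d.IsMinimizer y fstar) (hε : 0 < ε)
    (hs : d.Invariant s) (hg : g ∈ d.G s.xp s.tp)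
    (hopt : ε < ((d.f s.xp).toReal - fstar) / (d.fhat - fstar)) :
    ∃ γ, 3 / 4 * ε ≤ γ ∧ 3 / 4 - d.relHeight fstar s.t ≤ γ ∧
      γ ≤ ⟪d.P g, s.x - d.target y fstar s.t⟫_ℝ := by
  obtain ⟨α, hα, hα', hp⟩ := hs.exists_lineMap
  have hpos : 0 < d.fhat - fstar := sub_pos.2 (h.fstar_lt_fhat hy)
  have hf : (d.f s.xp).toReal ≤ s.tp := by
    have hle := (h.isClosed_epiOn.frontier_subset hs.mem_frontier).2
    rwa [← EReal.coe_le_coe_iff,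
      coe_toReal_of_mem_dom h.ne_bot (hle.trans_lt (EReal.coe_lt_top _))]
  have htp : s.tp = d.rayT s.t α := by
    rw [lineMap_center] at hp
    exact congrArg Prod.snd hp
  have hgap : ε ≤ 1 - α * d.relHeight fstar s.t := by
    calc ε ≤ (s.tp - fstar) / (d.fhat - fstar) := hopt.le.trans (by gcongr)
      _ = 1 - α * d.relHeight fstar s.t := by
        rw [← relHeight_rayT, ← htp, relHeight]
        field_simp
        ring
  have hα34 : 3 / 4 ≤ 1 / α := by
    rw [le_div_iff₀ hα]
    linarith
  refine ⟨1 / α - d.relHeight fstar s.t, ?_, by linarith,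
    h.one_div_sub_relHeight_le hy hs.map_x hs.t_le hp hg⟩
  calc 3 / 4 * ε ≤ 1 / α * (1 - α * d.relHeight fstar s.t) := by gcongr
    _ = 1 / α - d.relHeight fstar s.t := by field_simp

end Separation

section Potential

lemma potential_nonneg (h : d.IsConvexProgram) (hy : d.IsMinimizer y fstar) (hε : 0 < ε)
    (hs : d.Invariant s) : 0 ≤ d.potential y fstar ε s := by
  have hcost : 0 ≤ stepCost ε (d.rescalesLeft fstar s.t) := stepCost_nonneg hε
  have htotal := sub_nonneg.2 (stepCost_le_totalCost hε
    (h.rescalesLeft_nonneg hy (hs.fstar_le_t hy) hs.t_le))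
  unfold potential
  positivity

lemma potential_le (h : d.IsConvexProgram) (hD : d.Dbar ≠ ⊤) (hy : d.IsMinimizer y fstar)
    (hε : 0 < ε) (hs : d.Invariant s) (hx : s.x ∈ d.initSublevel) :
    d.potential y fstar ε s ≤ d.Dbar.toReal ^ 2 * totalCost ε (d.rescalesLeft fstar s.t) := by
  have hcost : 0 ≤ stepCost ε (d.rescalesLeft fstar s.t) := stepCost_nonneg hε
  have hdist := norm_sub_le_Dbar hD hx (h.target_mem_initSublevel hy (hs.fstar_le_t hy) hs.t_le)
  calc d.potential y fstar ε s ≤ stepCost ε (d.rescalesLeft fstar s.t) * d.Dbar.toReal ^ 2 +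
        d.Dbar.toReal ^ 2 *
          (totalCost ε (d.rescalesLeft fstar s.t) - stepCost ε (d.rescalesLeft fstar s.t)) := by
        unfold potential
        gcongr
    _ = d.Dbar.toReal ^ 2 * totalCost ε (d.rescalesLeft fstar s.t) := by ring

variable [FiniteDimensional ℝ E]

lemma stepCost_mul_norm_xtilde_sub_sq_add_le (h : d.IsConvexProgram)
    (hy : d.IsMinimizer y fstar) (hε : 0 < ε) (hρ : d.IsInnerRadius ρ)
    (hs : d.Invariant s) (hg : g ∈ d.G s.xp s.tp)
    (hopt : ε < ((d.f s.xp).toReal - fstar) / (d.fhat - fstar)) :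
    stepCost ε (d.rescalesLeft fstar s.t) * ‖d.xtilde ε s g - d.target y fstar s.t‖ ^ 2 + ρ ^ 2 ≤
      stepCost ε (d.rescalesLeft fstar s.t) * ‖s.x - d.target y fstar s.t‖ ^ 2 := by
  obtain ⟨γ, hγε, hγu, hγ⟩ := h.exists_gap hy hε hs hg hopt
  have hstep := norm_sub_smul_sq_add_le hε hρ.nonneg (by linarith) (h.mul_norm_P_le hρ hg) hγ
  have hcost : 1 ≤ stepCost ε (d.rescalesLeft fstar s.t) * (ε * γ - ε ^ 2 / 4) :=
    one_le_stepCost_mul hε (h.relHeight_pos hy hs.t_le) hγε hγu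
  calc _ ≤ stepCost ε (d.rescalesLeft fstar s.t) * ‖d.xtilde ε s g - d.target y fstar s.t‖ ^ 2 +
        ρ ^ 2 * (stepCost ε (d.rescalesLeft fstar s.t) * (ε * γ - ε ^ 2 / 4)) := by
        gcongr
        exact le_mul_of_one_le_right (sq_nonneg ρ) hcost
    _ = stepCost ε (d.rescalesLeft fstar s.t) * (‖d.xtilde ε s g - d.target y fstar s.t‖ ^ 2 +
        ρ ^ 2 * (ε * γ - ε ^ 2 / 4)) := by ring
    _ ≤ _ := mul_le_mul_of_nonneg_left hstep (stepCost_nonneg hε)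

lemma potential_step_le_of_le_alpha (h : d.IsConvexProgram) (hD : d.Dbar ≠ ⊤)
    (hy : d.IsMinimizer y fstar) (hε : 0 < ε) (hs : d.Invariant s)
    (hα : 4 / 3 ≤ d.alpha (d.xtilde ε s g) s.t) :
    d.potential y fstar ε (d.step ε s g) ≤ d.Dbar.toReal ^ 2 *
      (totalCost ε (d.rescalesLeft fstar s.t) - stepCost ε (d.rescalesLeft fstar s.t)) := by
  have hs' := h.invariant_step hy.mem_lowerBounds hs ε g
  have hx' : (d.step ε s g).x ∈ d.initSublevel := by
    have hmem := h.isClosed_epiOn.frontier_subset hs'.mem_frontier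
    have hA := hs'.map_x
    have ht := hs'.t_le
    rw [step_of_le d hα] at hmem hA ht ⊢
    exact ⟨⟨hmem.1, hA⟩, hmem.2.trans ((EReal.coe_le_coe_iff.2 ht).trans_eq h.coe_init_t)⟩
  have hL : d.rescalesLeft fstar (d.step ε s g).t + 1 ≤ d.rescalesLeft fstar s.t := by
    rw [step_of_le d hα]
    exact h.rescalesLeft_rayT_add_one_le hy hs.t_le hα
  refine (h.potential_le hD hy hε hs' hx').trans ?_
  gcongr
  linarith [stepCost_add_totalCost_le hε hL]

lemma potential_step_add_le (h : d.IsConvexProgram) (hD : d.Dbar ≠ ⊤)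
    (hy : d.IsMinimizer y fstar) (hε : 0 < ε) (hρ : d.IsInnerRadius ρ) (hs : d.Invariant s)
    (hg : g ∈ d.G s.xp s.tp) (hopt : ε < ((d.f s.xp).toReal - fstar) / (d.fhat - fstar)) :
    d.potential y fstar ε (d.step ε s g) + ρ ^ 2 ≤ d.potential y fstar ε s := by
  have hdrop := h.stepCost_mul_norm_xtilde_sub_sq_add_le hy hε hρ hs hg hopt
  rcases lt_or_ge (d.alpha (d.xtilde ε s g) s.t) (4 / 3) with hα | hα
  · rw [step_of_lt d hα]
    simp only [potential]
    linarith
  · have hrescale := h.potential_step_le_of_le_alpha hD hy hε hs hα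
    have : 0 ≤ stepCost ε (d.rescalesLeft fstar s.t) *
        ‖d.xtilde ε s g - d.target y fstar s.t‖ ^ 2 :=
      mul_nonneg (stepCost_nonneg hε) (sq_nonneg _)
    rw [potential.eq_def (s := s)]
    linarith

lemma potential_add_mul_le (h : d.IsConvexProgram) (hD : d.Dbar ≠ ⊤)
    (hy : d.IsMinimizer y fstar) (hε : 0 < ε) (hρ : d.IsInnerRadius ρ)
    {s : ℕ → State E} (hs : d.IsRun ε s) {n : ℕ}
    (hopt : ∀ k < n, ε < ((d.f (s k).xp).toReal - fstar) / (d.fhat - fstar)) :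
    d.potential y fstar ε (s n) + n * ρ ^ 2 ≤ d.potential y fstar ε d.init := by
  induction n with
  | zero => simp [hs.1]
  | succ n ih =>
    obtain ⟨g, hg, hstep⟩ := hs.2 n
    have hdrop := h.potential_step_add_le hD hy hε hρ (h.invariant_of_isRun hy.mem_lowerBounds hs n)
      hg (hopt n n.lt_succ_self)
    rw [hstep]
    push_cast
    linarith [ih fun k hk => hopt k (hk.trans n.lt_succ_self)]

lemma le_iterationBound_div (h : d.IsConvexProgram) (hD : d.Dbar ≠ ⊤)
    (hy : d.IsMinimizer y fstar) (hε : 0 < ε) (hρ : d.IsInnerRadius ρ) (hρ0 : 0 < ρ)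
    {s : ℕ → State E} (hs : d.IsRun ε s) {n : ℕ}
    (hopt : ∀ k < n, ε < ((d.f (s k).xp).toReal - fstar) / (d.fhat - fstar)) :
    n ≤ iterationBound ε (d.Dbar.toReal / ρ) := by
  have hnonneg := h.potential_nonneg hy hε (h.invariant_of_isRun hy.mem_lowerBounds hs n)
  have hL : d.rescalesLeft fstar d.init.t ≤ Real.logb (4 / 3) (1 + d.Dbar.toReal / ρ) :=
    Real.logb_le_logb_of_le (by norm_num) (inv_pos.2 (h.relHeight_pos hy le_rfl))
      (h.inv_relHeight_init_le hD hy hρ hρ0)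
  have hmul : n * ρ ^ 2 ≤ d.Dbar.toReal ^ 2 *
      (8 * (1 / ε ^ 2 + 1 / ε * Real.logb (4 / 3) (1 + d.Dbar.toReal / ρ))) := by
    calc (n : ℝ) * ρ ^ 2 ≤ d.potential y fstar ε d.init := by
          linarith [h.potential_add_mul_le hD hy hε hρ hs hopt]
      _ ≤ d.Dbar.toReal ^ 2 * totalCost ε (d.rescalesLeft fstar d.init.t) :=
          h.potential_le hD hy hε h.invariant_init ⟨h.ebar_mem_Feas, le_rfl⟩
      _ ≤ d.Dbar.toReal ^ 2 * (8 * (1 / ε ^ 2 + 1 / ε * d.rescalesLeft fstar d.init.t)) := by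
          gcongr
          exact totalCost_le _ _
      _ ≤ _ := by gcongr
  rw [← le_div_iff₀ (by positivity)] at hmul
  refine hmul.trans_eq ?_
  rw [iterationBound]
  ring

end Potential

section InnerRadius

variable [FiniteDimensional ℝ E]

lemma rhat_ne_zero (h : d.IsConvexProgram) : d.rhat ≠ 0 := by
  have hnhds : ∀ᶠ x in 𝓝 d.ebar, (x, d.fhat) ∈ d.epiOn :=
    ContinuousAt.eventually_mem (f := fun x => (x, d.fhat)) (by fun_prop)
      (mem_interior_iff_mem_nhds.1 h.center_mem_interior)
  obtain ⟨ρ, hρ, hball⟩ := Metric.nhds_basis_closedBall.eventually_iff.1 hnhds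
  have hle : ENNReal.ofReal ρ ≤ d.rhat :=
    le_sSup ⟨ρ, hρ.le, rfl, fun x hx => hball (mem_closedBall_iff_norm.2 hx.1)⟩
  exact ((ENNReal.ofReal_pos.2 hρ).trans_le hle).ne'

lemma exists_seq_isInnerRadius (h : d.IsConvexProgram) (hD : d.Dbar ≠ ⊤) :
    ∃ ρ : ℕ → ℝ, (∀ᶠ n in atTop, d.IsInnerRadius (ρ n) ∧ 0 < ρ n) ∧
      Tendsto (fun n => d.Dbar.toReal / ρ n) atTop (𝓝 (d.Dbar / d.rhat).toReal) := by
  have hzero (x : E) (hx : ‖x - d.ebar‖ ≤ 0 ∧ d.A x = d.b) : x ∈ d.S ∧ d.f x ≤ d.fhat := by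
    rw [sub_eq_zero.1 (norm_le_zero_iff.1 hx.1)]
    exact (interior_subset h.center_mem_interior : d.center ∈ d.epiOn)
  obtain ⟨r, -, hr, hmem⟩ := exists_seq_tendsto_sSup (S := {r | ∃ ρ : ℝ, 0 ≤ ρ ∧
    r = ENNReal.ofReal ρ ∧ ∀ x, ‖x - d.ebar‖ ≤ ρ ∧ d.A x = d.b → x ∈ d.S ∧ d.f x ≤ d.fhat})
    ⟨0, 0, le_rfl, ENNReal.ofReal_zero.symm, hzero⟩ (OrderTop.bddAbove _)
  choose ρ hρ0 hrρ hρ using hmem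
  have hlim : Tendsto (fun n => d.Dbar / r n) atTop (𝓝 (d.Dbar / d.rhat)) :=
    ENNReal.Tendsto.const_div hr (Or.inr hD)
  have hpos : ∀ᶠ n in atTop, 0 < ρ n := by
    filter_upwards [hr.eventually_ne h.rhat_ne_zero] with n hn
    exact ENNReal.ofReal_pos.1 (pos_iff_ne_zero.2 (hrρ n ▸ hn))
  refine ⟨ρ, hpos.mono fun n hn => ⟨⟨hρ0 n, fun x hx hA => hρ n x ⟨hx, hA⟩⟩, hn⟩, ?_⟩
  refine ((ENNReal.tendsto_toReal (ENNReal.div_ne_top hD h.rhat_ne_zero)).comp hlim).congr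
    fun n => ?_
  rw [Function.comp_apply, ENNReal.toReal_div, hrρ, ENNReal.toReal_ofReal (hρ0 n)]

lemma exists_optimal (h : d.IsConvexProgram) (hD : d.Dbar ≠ ⊤) (hy : d.IsMinimizer y fstar)
    (hε : 0 < ε) {s : ℕ → State E} (hs : d.IsRun ε s) {ℓ : ℕ}
    (hℓ : iterationBound ε (d.Dbar / d.rhat).toReal ≤ ℓ) :
    ∃ k ≤ ℓ, ((d.f (s k).xp).toReal - fstar) / (d.fhat - fstar) ≤ ε := by
  by_contra! hopt
  obtain ⟨ρ, hρ, hlim⟩ := h.exists_seq_isInnerRadius hD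
  have hbound : ((ℓ + 1 : ℕ) : ℝ) ≤ iterationBound ε (d.Dbar / d.rhat).toReal :=
    ge_of_tendsto ((continuousAt_iterationBound ε ENNReal.toReal_nonneg).tendsto.comp hlim)
      (hρ.mono fun n hn => h.le_iterationBound_div hD hy hε hn.1 hn.2 hs
        fun k hk => hopt k (Nat.le_of_lt_succ hk))
  push_cast at hbound
  linarith

end InnerRadius

end IsConvexProgram

end Data

end SubgradA

end

theorem theorem1p1 {E F : Type*} [NormedAddCommGroup E] [InnerProductSpace ℝ E]
    [FiniteDimensional ℝ E] [AddCommGroup F] [Module ℝ F] (d : SubgradA.Data E F)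
    (hf_bot : ∀ x, d.f x ≠ ⊥) (hf_lsc : LowerSemicontinuous d.f)
    (hf_convex : Convex ℝ (SubgradA.epi d.f))
    (hS_closed : IsClosed d.S) (hS_convex : Convex ℝ d.S)
    (he_int : d.ebar ∈ interior (d.S ∩ SubgradA.dom d.f)) (he_eq : d.A d.ebar = d.b)
    (hfhat : d.f d.ebar < (d.fhat : EReal)) (hD : d.Dbar ≠ ⊤)
    (ε : ℝ) (hε0 : 0 < ε) (hε1 : ε < 1) :
    (∃ s : ℕ → SubgradA.State E, d.IsRun ε s) ∧
    ∃ fstar : ℝ, IsLeast (d.f '' d.Feas) (fstar : EReal) ∧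
      ∀ s : ℕ → SubgradA.State E, d.IsRun ε s →
        (∀ k, (s k).xp ∈ d.Feas ∧ d.f (s k).xp < ⊤) ∧
        ∀ ℓ : ℕ,
          8 * (d.Dbar / d.rhat).toReal ^ 2 *
            (1 / ε ^ 2 + 1 / ε * Real.logb (4 / 3) (1 + (d.Dbar / d.rhat).toReal)) ≤ (ℓ : ℝ) →
          ∃ k ≤ ℓ, ((d.f (s k).xp).toReal - fstar) / (d.fhat - fstar) ≤ ε := by
  have h : d.IsConvexProgram :=
    ⟨hf_bot, hf_lsc, hf_convex, hS_closed, hS_convex, he_int, he_eq, hfhat⟩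
  obtain ⟨y, fstar, hy⟩ := h.exists_isMinimizer hD
  refine ⟨h.exists_isRun hy.mem_lowerBounds ε, fstar,
    ⟨⟨y, hy.mem_Feas, hy.f_eq⟩, hy.mem_lowerBounds⟩, fun s hs => ⟨fun k => ?_, fun ℓ hℓ => ?_⟩⟩
  · exact h.xp_mem_Feas_inter_dom (h.invariant_of_isRun hy.mem_lowerBounds hs k)
  · exact h.exists_optimal hD hy hε0 hs hℓ
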